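/- Let $X$ be a finite abstract simplicial complex on a finite vertex set $V$ (every $\{v\}$, $v\in V$, is a simplex of $X$, and so is $\emptyset$), and assume that $X$ is not the full simplex on a nonempty vertex set. A missing face of $X$ is a set $\tau\subseteq V$ with $\tau\notin X$ such that every proper subset of $\tau$ belongs to $X$; its dimension is $|\tau|-1$. Let $D(X)$ be the set of dimensions of the missing faces of $X$ (so $r\ge 1$ for all $r\in D(X)$), and let $S(X)=\bigcup_{r\in D(X)}\binom{V}{r-1}$. A vector representation $P$ of $X$ is a family of maps $P_\sigma:V\to\mathbb{R}^{\ell_\sigma}$, $\sigma\in S(X)$, such that for all $\sigma\in S(X)$ and $v,w\in V$ one has $P_\sigma(v)\cdot P_\sigma(w)\ge 0$, and $P_\sigma(v)\cdot P_\sigma(w)\ge 1$ whenever $v\neq w$, $v,w\notin\sigma$ and $\sigma\cup\{v,w\}$ is a missing face of $X$. A family of nonnegative functions $\alpha_\sigma:V\to\mathbb{R}_{\ge0}$, $\sigma\in S(X)$, is dominating for $P$ if $\sum_{\sigma\in S(X)}\sum_{v\in V}\alpha_\sigma(v)\,P_\sigma(v)\cdot P_\sigma(w)\ge 1$ for every $w\in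 V$. The value $|P|\in[0,\infty]$ is the infimum of $\sum_{\sigma\in S(X)}\sum_{v\in V}\alpha_\sigma(v)$ over all dominating families ($\infty$ if there are none), and the vector domination number of $X$ is $\Gamma(X)=\sup_P|P|\in[0,\infty]$, the supremum over all vector representations of $X$. The homological connectivity of $X$ is $\eta(X)=1+\min\{j\ge -1:\tilde H_j(X;\mathbb{R})\ne 0\}$, with $\eta(X)=\infty$ if all reduced homology groups vanish. Set $\binom{\infty}{r}=\infty$ for $r\ge 1$. Then $$\Gamma(X)\le\sum_{r\in D(X)} r\binom{\eta(X)}{r}.$$ -/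

import Mathlib

open scoped ENNReal

noncomputable section

namespace VectorDomination

/-- The simplices of `X`, including the empty one (Mathlib's `AbstractSimplicialComplex`
records only the nonempty simplices, and contains every singleton). -/
def IsSimplex {V : Type*} (X : AbstractSimplicialComplex V) (σ : Finset V) : Prop :=
  σ = ∅ ∨ σ ∈ X

/-- A missing face: a set of vertices that is not a simplex while all its proper subsets are. -/
def IsMissingFace {V : Type*} (X : AbstractSimplicialComplex V) (τ : Finset V) : Prop :=
  ¬ IsSimplex X τ ∧ ∀ σ, σ ⊂ τ → IsSimplex X σ

open Classical in
/-- The set of dimensions (cardinality minus one) of the missing faces of `X`. -/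
def missingDims {V : Type*} [Fintype V] (X : AbstractSimplicialComplex V) : Finset ℕ :=
  (Finset.range (Fintype.card V)).filter fun r => ∃ τ, IsMissingFace X τ ∧ τ.card = r + 1

/-! ### Reduced simplicial homology with real coefficients -/

open Classical in
/-- The simplices of `X` with `s` vertices, i.e. of dimension `s - 1`. -/
def faces {V : Type*} [Fintype V] (X : AbstractSimplicialComplex V) (s : ℕ) :
    Finset (Finset V) :=
  Finset.univ.filter fun σ => IsSimplex X σ ∧ σ.card = s

/-- The incidence number `[σ : τ]`: it is `(-1) ^ i` if `τ` arises from `σ` by deleting its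
`i`-th vertex (counted from `0`, in increasing order), and `0` if `τ` does not arise so. -/
def incidence {V : Type*} [LinearOrder V] (σ τ : Finset V) : ℝ :=
  ∑ v ∈ σ, if σ.erase v = τ then (-1) ^ (σ.filter (· < v)).card else 0

/-- The matrix of the boundary map from chains on simplices with `s + 1` vertices to chains on
simplices with `s` vertices. For `s = 0` it is the augmentation. -/
def boundaryMatrix {V : Type*} [Fintype V] [LinearOrder V] (X : AbstractSimplicialComplex V)
    (s : ℕ) : Matrix (faces X s) (faces X (s + 1)) ℝ :=
  Matrix.of fun τ σ => incidence σ.1 τ.1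

/-- The boundary map `C_s(X; ℝ) → C_{s-1}(X; ℝ)` (subscripts are dimensions). -/
def boundary {V : Type*} [Fintype V] [LinearOrder V] (X : AbstractSimplicialComplex V) (s : ℕ) :
    (faces X (s + 1) → ℝ) →ₗ[ℝ] (faces X s → ℝ) :=
  (boundaryMatrix X s).mulVecLin

/-- The cycles among the chains on simplices with `s` vertices. -/
def cycles {V : Type*} [Fintype V] [LinearOrder V] (X : AbstractSimplicialComplex V) :
    (s : ℕ) → Submodule ℝ (faces X s → ℝ)
  | 0 => ⊤
  | s + 1 => LinearMap.ker (boundary X s)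

/-- The boundaries among the chains on simplices with `s` vertices. -/
def boundaries {V : Type*} [Fintype V] [LinearOrder V] (X : AbstractSimplicialComplex V)
    (s : ℕ) : Submodule ℝ (faces X s → ℝ) :=
  LinearMap.range (boundary X s)

/-- `ReducedHomology X s` is the reduced homology of `X` in dimension `s - 1`. -/
abbrev ReducedHomology {V : Type*} [Fintype V] [LinearOrder V]
    (X : AbstractSimplicialComplex V) (s : ℕ) : Type _ :=
  cycles X s ⧸ (boundaries X s).submoduleOf (cycles X s)

/-- The homological connectivity `η(X) = 1 + min {j ≥ -1 : H̃_j(X; ℝ) ≠ 0}`, which is `⊤` if all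
reduced homology vanishes. Here `s = j + 1`. -/
def eta {V : Type*} [Fintype V] [LinearOrder V] (X : AbstractSimplicialComplex V) : ℕ∞ :=
  ⨅ (s : ℕ) (_ : Nontrivial (ReducedHomology X s)), (s : ℕ∞)

/-! ### Vector representations and vector domination -/

open Classical in
/-- The index set of a vector representation: all sets of `r - 1` vertices, where `r` ranges over
the dimensions of missing faces of `X`. -/
def repSets {V : Type*} [Fintype V] (X : AbstractSimplicialComplex V) : Finset (Finset V) :=
  Finset.univ.filter fun σ => σ.card + 1 ∈ missingDims X

/-- A vector representation of `X`. Only the maps `vec σ` with `σ ∈ repSets X` matter. The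
cardinality condition in `one_le` says that `v`, `w` are distinct and outside `σ`. -/
structure VectorRep {V : Type*} [Fintype V] [DecidableEq V] (X : AbstractSimplicialComplex V) where
  dim : Finset V → ℕ
  vec : (σ : Finset V) → V → EuclideanSpace ℝ (Fin (dim σ))
  nonneg : ∀ σ ∈ repSets X, ∀ v w, 0 ≤ inner ℝ (vec σ v) (vec σ w)
  one_le : ∀ σ ∈ repSets X, ∀ v w, (insert v (insert w σ)).card = σ.card + 2 →
    IsMissingFace X (insert v (insert w σ)) → 1 ≤ inner ℝ (vec σ v) (vec σ w)

/-- A family `α` of nonnegative vectors `α σ ∈ ℝ^V`, `σ ∈ repSets X`, is dominating for `P` if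
`∑ σ, α_σ P_σ P_σᵀ ≥ 1` in every coordinate `w`. -/
def IsDominating {V : Type*} [Fintype V] [DecidableEq V] {X : AbstractSimplicialComplex V}
    (P : VectorRep X) (α : Finset V → V → ℝ) : Prop :=
  (∀ σ ∈ repSets X, ∀ v, 0 ≤ α σ v) ∧
    ∀ w, 1 ≤ ∑ σ ∈ repSets X, ∑ v, α σ v * inner ℝ (P.vec σ v) (P.vec σ w)

/-- The value `|P|`: the least total weight of a dominating family (`∞` if there is none). -/
def VectorRep.value {V : Type*} [Fintype V] [DecidableEq V] {X : AbstractSimplicialComplex V}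
    (P : VectorRep X) : ℝ≥0∞ :=
  ⨅ (α : Finset V → V → ℝ) (_ : IsDominating P α),
    ENNReal.ofReal (∑ σ ∈ repSets X, ∑ v, α σ v)

/-- The vector domination number `Γ(X)`. -/
def Gamma {V : Type*} [Fintype V] [DecidableEq V] (X : AbstractSimplicialComplex V) : ℝ≥0∞ :=
  ⨆ P : VectorRep X, P.value

/-- Binomial coefficients with a possibly infinite upper entry: `C(∞, 0) = 1` and `C(∞, r) = ∞`
for `r ≥ 1`. -/
def enatChoose : ℕ∞ → ℕ → ℕ∞
  | some n, r => (n.choose r : ℕ)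
  | none, 0 => 1
  | none, _ + 1 => ⊤

end VectorDomination

end

/-!
Give the vertices positive weights `s v`. Chains on the full simplex form the exterior algebra on
`V`, so by the canonical anticommutation relations the Laplacian of the coboundary weighted by `s`
is multiplication by `∑ v, s v ^ 2`. A nontrivial class in `ReducedHomology X k` has a harmonic
representative `φ`, whose weighted coboundary therefore has energy `(∑ v, s v ^ 2) * ‖φ‖ ^ 2`.

This coboundary is supported on nonsimplices of `X`, and each of these contains a missing face `M`.
Only the vertices of `M` contribute to its value there. Grouping them in pairs `v ≠ w`, each pair
has inner product at least `1` in the vector representation, at the index `M \ {v, w}`. If `s ^ 2`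
is a fractional packing for the vector representation, the Gram matrices then bound the energy by
`(∑ r ∈ missingDims X, r * k.choose r) * ‖φ‖ ^ 2`. So this sum bounds the weight of every fractional
packing, and by linear programming duality there is a dominating family of that weight.
-/

noncomputable section

namespace VectorDomination

open scoped Matrix

section Operators

variable {V R : Type*} [LinearOrder V] [CommRing R]

/-- The sign `(-1) ^ i`, where `i` is the number of elements of `τ` below `v`. -/
def orderSign (v : V) (τ : Finset V) : R :=
  (-1) ^ (τ.filter (· < v)).card

lemma orderSign_mul_self (v : V) (τ : Finset V) :
    (orderSign v τ * orderSign v τ : R) = 1 := by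
  rw [orderSign, ← mul_pow, neg_one_mul, neg_neg, one_pow]

lemma orderSign_insert_self (v : V) (τ : Finset V) :
    (orderSign v (insert v τ) : R) = orderSign v τ := by
  rw [orderSign, Finset.filter_insert, if_neg (lt_irrefl v), orderSign]

lemma orderSign_erase_self (v : V) (τ : Finset V) :
    (orderSign v (τ.erase v) : R) = orderSign v τ := by
  rcases em (v ∈ τ) with h | h
  · rw [← orderSign_insert_self, Finset.insert_erase h]
  · rw [Finset.erase_eq_of_notMem h]

lemma orderSign_insert_of_le {u v : V} (h : v ≤ u) (τ : Finset V) :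
    (orderSign v (insert u τ) : R) = orderSign v τ := by
  rw [orderSign, Finset.filter_insert, if_neg h.not_gt, orderSign]

lemma orderSign_insert_of_lt {u v : V} {τ : Finset V} (h : u < v) (hu : u ∉ τ) :
    (orderSign v (insert u τ) : R) = -orderSign v τ := by
  rw [orderSign, Finset.filter_insert, if_pos h, Finset.card_insert_of_notMem (by simp [hu]),
    pow_succ, mul_neg_one, orderSign]

lemma orderSign_insert_mul_orderSign {v w : V} {ρ : Finset V} (hvw : v ≠ w) (hv : v ∉ ρ)
    (hw : w ∉ ρ) :
    (orderSign v (insert w ρ) * orderSign w ρ : R) =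
      -(orderSign w (insert v ρ) * orderSign v ρ) := by
  rcases hvw.lt_or_gt with h | h
  · rw [orderSign_insert_of_le h.le, orderSign_insert_of_lt h hv]; ring
  · rw [orderSign_insert_of_lt h hw, orderSign_insert_of_le h.le]; ring

/-- Exterior multiplication by the vertex `v`, on cochains of the full simplex on `V`: a cochain
is a function on `Finset V`, the exterior algebra of `V → R` written in its standard basis. -/
def creation (v : V) : Module.End R (Finset V → R) where
  toFun φ τ := if v ∈ τ then orderSign v τ * φ (τ.erase v) else 0
  map_add' φ ψ := by ext τ; simp only [Pi.add_apply]; split_ifs <;> ring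
  map_smul' a φ := by
    ext τ; simp only [Pi.smul_apply, smul_eq_mul, RingHom.id_apply]; split_ifs <;> ring

/-- Contraction by the vertex `v`, the adjoint of `creation v`. -/
def annihilation (v : V) : Module.End R (Finset V → R) where
  toFun φ τ := if v ∈ τ then 0 else orderSign v τ * φ (insert v τ)
  map_add' φ ψ := by ext τ; simp only [Pi.add_apply]; split_ifs <;> ring
  map_smul' a φ := by
    ext τ; simp only [Pi.smul_apply, smul_eq_mul, RingHom.id_apply]; split_ifs <;> ring

lemma creation_of_mem {v : V} {τ : Finset V} (h : v ∈ τ) (φ : Finset V → R) :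
    creation v φ τ = orderSign v τ * φ (τ.erase v) :=
  if_pos h

lemma creation_of_notMem {v : V} {τ : Finset V} (h : v ∉ τ) (φ : Finset V → R) :
    creation v φ τ = 0 :=
  if_neg h

lemma creation_insert {v : V} {τ : Finset V} (h : v ∉ τ) (φ : Finset V → R) :
    creation v φ (insert v τ) = orderSign v τ * φ τ := by
  rw [creation_of_mem (Finset.mem_insert_self v τ), orderSign_insert_self, Finset.erase_insert h]

lemma annihilation_of_mem {v : V} {τ : Finset V} (h : v ∈ τ) (φ : Finset V → R) :
    annihilation v φ τ = 0 :=
  if_pos h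

lemma annihilation_of_notMem {v : V} {τ : Finset V} (h : v ∉ τ) (φ : Finset V → R) :
    annihilation v φ τ = orderSign v τ * φ (insert v τ) :=
  if_neg h

lemma annihilation_mul_self (v : V) :
    (annihilation v * annihilation v : Module.End R (Finset V → R)) = 0 := by
  ext φ τ
  by_cases hv : v ∈ τ
  · exact annihilation_of_mem hv _
  · simp [annihilation_of_notMem hv, annihilation_of_mem (Finset.mem_insert_self v τ)]

lemma annihilation_anticomm (v w : V) :
    (annihilation v * annihilation w : Module.End R (Finset V → R)) =
      -(annihilation w * annihilation v) := by
  rcases eq_or_ne v w with rfl | hvw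
  · rw [annihilation_mul_self, neg_zero]
  refine LinearMap.ext fun φ => funext fun τ => ?_
  simp only [Module.End.mul_apply, LinearMap.neg_apply, Pi.neg_apply]
  by_cases hv : v ∈ τ
  · by_cases hw : w ∈ τ
    · simp [annihilation_of_mem, hv, hw]
    · simp [annihilation_of_mem, annihilation_of_notMem, hv, hw]
  by_cases hw : w ∈ τ
  · simp [annihilation_of_mem, annihilation_of_notMem, hv, hw]
  rw [annihilation_of_notMem hv, annihilation_of_notMem hw,
    annihilation_of_notMem (by simp [hvw.symm, hw]), annihilation_of_notMem (by simp [hvw, hv]),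
    Finset.insert_comm w v]
  linear_combination φ (insert v (insert w τ)) *
    orderSign_insert_mul_orderSign (R := R) hvw hv hw

lemma creation_mul_annihilation_self_add (v : V) :
    creation v * annihilation v + annihilation v * creation v =
      (1 : Module.End R (Finset V → R)) := by
  refine LinearMap.ext fun φ => funext fun τ => ?_
  simp only [LinearMap.add_apply, Module.End.mul_apply, Pi.add_apply, Module.End.one_apply]
  by_cases hv : v ∈ τ
  · rw [annihilation_of_mem hv, add_zero, creation_of_mem hv,
      annihilation_of_notMem (Finset.notMem_erase v τ), orderSign_erase_self, ← mul_assoc,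
      orderSign_mul_self, one_mul, Finset.insert_erase hv]
  · rw [creation_of_notMem hv, zero_add, annihilation_of_notMem hv, creation_insert hv,
      ← mul_assoc, orderSign_mul_self, one_mul]

lemma creation_mul_annihilation_of_ne {v w : V} (hvw : v ≠ w) :
    creation v * annihilation w = -(annihilation w * creation v : Module.End R (Finset V → R)) := by
  refine LinearMap.ext fun φ => funext fun τ => ?_
  simp only [Module.End.mul_apply, LinearMap.neg_apply, Pi.neg_apply]
  by_cases hw : w ∈ τ
  · rw [annihilation_of_mem hw, neg_zero]
    by_cases hv : v ∈ τ
    · rw [creation_of_mem hv, annihilation_of_mem (by simp [hvw.symm, hw]), mul_zero]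
    · rw [creation_of_notMem hv]
  rw [annihilation_of_notMem hw]
  by_cases hv : v ∈ τ
  · obtain ⟨ρ, hρ, rfl⟩ : ∃ ρ, v ∉ ρ ∧ insert v ρ = τ :=
      ⟨τ.erase v, Finset.notMem_erase v τ, Finset.insert_erase hv⟩
    have hwρ : w ∉ ρ := fun h => hw (Finset.mem_insert_of_mem h)
    rw [creation_insert hρ, annihilation_of_notMem hwρ, Finset.insert_comm,
      creation_insert (by simp [hvw, hρ])]
    linear_combination φ (insert w ρ) *
      (orderSign w ρ * orderSign w (insert v ρ) *
          orderSign_insert_mul_orderSign (R := R) hvw hρ hwρ -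
        orderSign v (insert w ρ) * orderSign w (insert v ρ) * orderSign_mul_self (R := R) w ρ -
        orderSign v ρ * orderSign w ρ * orderSign_mul_self (R := R) w (insert v ρ))
  · rw [creation_of_notMem hv, creation_of_notMem (by simp [hvw, hv]), mul_zero, neg_zero]

lemma creation_mul_annihilation_add (v w : V) :
    creation v * annihilation w + annihilation w * creation v =
      if v = w then (1 : Module.End R (Finset V → R)) else 0 := by
  split_ifs with h
  · rw [h, creation_mul_annihilation_self_add]
  · rw [creation_mul_annihilation_of_ne h, neg_add_cancel]

lemma mul_annihilation_prod_inv_mul {K : Type*} [Field K] {s : V → K} (hs : ∀ v, s v ≠ 0) (v : V)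
    (g : Finset V → K) (τ : Finset V) :
    s v * annihilation v (fun σ => (∏ u ∈ σ, s u)⁻¹ * g σ) τ =
      (∏ u ∈ τ, s u)⁻¹ * annihilation v g τ := by
  by_cases hv : v ∈ τ
  · rw [annihilation_of_mem hv, annihilation_of_mem hv, mul_zero, mul_zero]
  · rw [annihilation_of_notMem hv, annihilation_of_notMem hv, Finset.prod_insert hv, mul_inv]
    have := hs v
    field_simp

variable [Fintype V]

lemma sum_filter_mem_erase {M : Type*} [AddCommMonoid M] (v : V) (F : Finset V → M) :
    ∑ τ : Finset V with v ∈ τ, F (τ.erase v) = ∑ ω : Finset V with v ∉ ω, F ω := by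
  refine Finset.sum_nbij' (fun τ => τ.erase v) (fun ω => insert v ω) ?_ ?_ ?_ ?_ ?_
  all_goals simp +contextual [Finset.insert_erase]

lemma sum_sum_mem_erase {M : Type*} [AddCommMonoid M] (F : V → Finset V → M) :
    ∑ τ : Finset V, ∑ v ∈ τ, F v (τ.erase v) = ∑ ω : Finset V, ∑ v ∈ ωᶜ, F v ω := by
  rw [Finset.sum_comm' (t' := Finset.univ) (s' := fun v => {τ : Finset V | v ∈ τ}) (by simp),
    Finset.sum_comm' (t' := Finset.univ) (s' := fun v => {ω : Finset V | v ∉ ω}) (by simp)]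
  exact Finset.sum_congr rfl fun v _ => sum_filter_mem_erase v (F v)

lemma creation_dotProduct (v : V) (φ ψ : Finset V → R) :
    creation v φ ⬝ᵥ ψ = φ ⬝ᵥ annihilation v ψ := by
  have h := sum_filter_mem_erase v fun ω => orderSign v ω * φ ω * ψ (insert v ω)
  rw [Finset.sum_filter, Finset.sum_filter] at h
  refine Eq.trans (Finset.sum_congr rfl fun τ _ => ?_)
    (h.trans (Finset.sum_congr rfl fun ω _ => ?_))
  · split_ifs with hv
    · rw [creation_of_mem hv, orderSign_erase_self, Finset.insert_erase hv]
    · rw [creation_of_notMem hv, zero_mul]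
  · by_cases hv : v ∈ ω
    · rw [annihilation_of_mem hv, mul_zero, if_neg (not_not.2 hv)]
    · rw [annihilation_of_notMem hv, if_pos hv]; ring

lemma sum_sum_mul_annihilation_sq (g : Finset V → R) (φ : Finset V → R) :
    ∑ ω, g ω * ∑ v, annihilation v φ ω ^ 2 = ∑ τ, (∑ v ∈ τ, g (τ.erase v)) * φ τ ^ 2 := by
  have annihilation_sq (ω : Finset V) :
      ∑ v, annihilation v φ ω ^ 2 = ∑ v ∈ ωᶜ, φ (insert v ω) ^ 2 := by
    symm
    refine Finset.sum_subset_zero_on_sdiff (Finset.subset_univ _) (fun v hv => ?_) fun v hv => ?_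
    · rw [annihilation_of_mem (by simpa using hv), sq, zero_mul]
    · rw [annihilation_of_notMem (Finset.mem_compl.1 hv)]
      linear_combination -φ (insert v ω) ^ 2 * orderSign_mul_self (R := R) v ω
  simp_rw [annihilation_sq, Finset.mul_sum, Finset.sum_mul]
  rw [← sum_sum_mem_erase fun v ω => g ω * φ (insert v ω) ^ 2]
  refine Finset.sum_congr rfl fun τ _ => Finset.sum_congr rfl fun v hv => ?_
  rw [Finset.insert_erase hv]

/-- The coboundary of the full simplex in which adding the vertex `v` is weighted by `s v`. -/
def weightedCoboundary (s : V → R) : Module.End R (Finset V → R) :=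
  ∑ v, s v • creation v

/-- The boundary of the full simplex in which deleting the vertex `v` is weighted by `s v`. -/
def weightedBoundary (s : V → R) : Module.End R (Finset V → R) :=
  ∑ v, s v • annihilation v

lemma weightedCoboundary_apply (s : V → R) (φ : Finset V → R) (τ : Finset V) :
    weightedCoboundary s φ τ = ∑ v, s v * creation v φ τ := by
  simp [weightedCoboundary]

lemma weightedBoundary_apply (s : V → R) (φ : Finset V → R) (τ : Finset V) :
    weightedBoundary s φ τ = ∑ v, s v * annihilation v φ τ := by
  simp [weightedBoundary]

lemma weightedCoboundary_dotProduct (s : V → R) (φ ψ : Finset V → R) :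
    weightedCoboundary s φ ⬝ᵥ ψ = φ ⬝ᵥ weightedBoundary s ψ := by
  simp [weightedCoboundary, weightedBoundary, sum_dotProduct, dotProduct_sum, creation_dotProduct]

lemma weightedBoundary_mul_self (s : V → R) : weightedBoundary s * weightedBoundary s = 0 := by
  simp only [weightedBoundary, Finset.sum_mul_sum, ← Finset.sum_product', smul_mul_smul_comm]
  refine Finset.sum_involution (fun p _ => p.swap) (fun p _ => ?_) (fun p _ hp hswap => hp ?_)
    (by simp) (by simp)
  · rw [annihilation_anticomm, mul_comm (s p.1), smul_neg]
    exact neg_add_cancel _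
  · obtain ⟨v, w⟩ := p
    obtain rfl : w = v := congrArg Prod.fst hswap
    rw [annihilation_mul_self, smul_zero]

lemma weightedCoboundary_mul_weightedBoundary_add (s t : V → R) :
    weightedCoboundary s * weightedBoundary t + weightedBoundary t * weightedCoboundary s =
      (s ⬝ᵥ t) • (1 : Module.End R (Finset V → R)) := by
  simp only [weightedCoboundary, weightedBoundary, Finset.sum_mul_sum, smul_mul_smul_comm]
  rw [Finset.sum_comm (γ := V) (f := fun v w => (t v * s w) • (annihilation v * creation w)),
    ← Finset.sum_add_distrib, dotProduct, Finset.sum_smul]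
  refine Finset.sum_congr rfl fun v _ => ?_
  simp only [mul_comm (t _) (s v), ← Finset.sum_add_distrib, ← smul_add,
    creation_mul_annihilation_add, smul_ite, smul_zero, Finset.sum_ite_eq, Finset.mem_univ, if_true]

lemma weightedCoboundary_dotProduct_self_add (s : V → R) (φ : Finset V → R) :
    weightedCoboundary s φ ⬝ᵥ weightedCoboundary s φ +
      weightedBoundary s φ ⬝ᵥ weightedBoundary s φ = (s ⬝ᵥ s) * (φ ⬝ᵥ φ) := by
  have laplacian := congrArg (φ ⬝ᵥ ·)
    (LinearMap.congr_fun (weightedCoboundary_mul_weightedBoundary_add s s) φ)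
  simp only [LinearMap.add_apply, Module.End.mul_apply, dotProduct_add, LinearMap.smul_apply,
    Module.End.one_apply, dotProduct_smul, smul_eq_mul] at laplacian
  rw [← laplacian, weightedCoboundary_dotProduct, dotProduct_comm φ (weightedCoboundary s _),
    weightedCoboundary_dotProduct, add_comm]

lemma weightedBoundary_prod_inv_mul {K : Type*} [Field K] {s : V → K} (hs : ∀ v, s v ≠ 0)
    (g : Finset V → K) (τ : Finset V) :
    weightedBoundary s (fun σ => (∏ v ∈ σ, s v)⁻¹ * g σ) τ =
      (∏ v ∈ τ, s v)⁻¹ * ∑ v, annihilation v g τ := by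
  rw [weightedBoundary_apply, Finset.mul_sum]
  exact Finset.sum_congr rfl fun v _ => mul_annihilation_prod_inv_mul hs v g τ

end Operators

section Simplices

variable {V : Type*} {X : AbstractSimplicialComplex V} {σ τ M : Finset V} {k r : ℕ}

lemma IsSimplex.mono (hτ : IsSimplex X τ) (h : σ ⊆ τ) : IsSimplex X σ := by
  rcases σ.eq_empty_or_nonempty with rfl | hσ
  · exact Or.inl rfl
  · rcases hτ with rfl | hτ
    · exact absurd (Finset.subset_empty.1 h) hσ.ne_empty
    · exact Or.inr ((X.isRelLowerSet_faces hτ).2 h hσ)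

lemma exists_isMissingFace_subset (hτ : ¬ IsSimplex X τ) : ∃ M ⊆ τ, IsMissingFace X M := by
  induction τ using Finset.strongInduction with
  | H τ ih =>
    by_cases h : ∀ σ, σ ⊂ τ → IsSimplex X σ
    · exact ⟨τ, subset_rfl, hτ, h⟩
    · push Not at h
      obtain ⟨σ, hστ, hσ⟩ := h
      obtain ⟨M, hMσ, hM⟩ := ih σ hστ hσ
      exact ⟨M, hMσ.trans hστ.subset, hM⟩

lemma IsMissingFace.two_le_card (hM : IsMissingFace X M) : 2 ≤ M.card := by
  by_contra! h
  obtain h | h : M.card = 0 ∨ M.card = 1 := by omega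
  · exact hM.1 (Or.inl (Finset.card_eq_zero.1 h))
  · obtain ⟨v, rfl⟩ := Finset.card_eq_one.1 h
    exact hM.1 (Or.inr (X.singleton_mem v))

variable [Fintype V]

lemma mem_faces : σ ∈ faces X k ↔ IsSimplex X σ ∧ σ.card = k := by
  simp [faces]

lemma mem_repSets : σ ∈ repSets X ↔ σ.card + 1 ∈ missingDims X := by
  simp [repSets]

lemma one_le_of_mem_missingDims (hr : r ∈ missingDims X) : 1 ≤ r := by
  simp only [missingDims, Finset.mem_filter] at hr
  obtain ⟨-, M, hM, hcard⟩ := hr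
  have := hM.two_le_card
  omega

lemma IsMissingFace.card_sub_one_mem_missingDims (hM : IsMissingFace X M) :
    M.card - 1 ∈ missingDims X := by
  have := hM.two_le_card
  have := Finset.card_le_univ M
  simp only [missingDims, Finset.mem_filter, Finset.mem_range]
  exact ⟨by omega, M, hM, by omega⟩

lemma missingDims_nonempty [Nonempty V] (hX : Finset.univ ∉ X) : (missingDims X).Nonempty := by
  obtain ⟨M, -, hM⟩ := exists_isMissingFace_subset (X := X) (τ := Finset.univ)
    fun h => h.elim Finset.univ_nonempty.ne_empty hX
  exact ⟨_, hM.card_sub_one_mem_missingDims⟩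

variable [DecidableEq V]

lemma IsMissingFace.erase_erase_mem_repSets (hM : IsMissingFace X M) {v w : V} (hv : v ∈ M)
    (hw : w ∈ M.erase v) : (M.erase v).erase w ∈ repSets X := by
  rw [mem_repSets, Finset.card_erase_add_one hw, Finset.card_erase_of_mem hv]
  exact hM.card_sub_one_mem_missingDims

lemma filter_repSets_subset (ω : Finset V) :
    {σ ∈ repSets X | σ ⊆ ω} = (missingDims X).biUnion fun r => ω.powersetCard (r - 1) := by
  ext σ
  simp only [Finset.mem_filter, mem_repSets, Finset.mem_biUnion, Finset.mem_powersetCard]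
  constructor
  · rintro ⟨hσ, hσω⟩
    exact ⟨_, hσ, hσω, rfl⟩
  · rintro ⟨r, hr, hσω, hcard⟩
    rw [hcard, Nat.sub_add_cancel (one_le_of_mem_missingDims hr)]
    exact ⟨hr, hσω⟩

lemma card_filter_repSets_subset (ω : Finset V) :
    {σ ∈ repSets X | σ ⊆ ω}.card = ∑ r ∈ missingDims X, ω.card.choose (r - 1) := by
  rw [filter_repSets_subset, Finset.card_biUnion]
  · simp only [Finset.card_powersetCard]
  · refine fun r hr q hq hrq => Finset.disjoint_left.2 fun σ hσr hσq => hrq ?_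
    have := (Finset.mem_powersetCard.1 hσr).2
    have := (Finset.mem_powersetCard.1 hσq).2
    have := one_le_of_mem_missingDims hr
    have := one_le_of_mem_missingDims hq
    omega

lemma sum_card_filter_repSets_subset_erase (τ : Finset V) :
    ∑ v ∈ τ, {σ ∈ repSets X | σ ⊆ τ.erase v}.card =
      ∑ r ∈ missingDims X, r * τ.card.choose r := by
  simp only [card_filter_repSets_subset]
  rw [Finset.sum_comm]
  refine Finset.sum_congr rfl fun r hr => ?_
  obtain ⟨q, rfl⟩ := Nat.exists_eq_add_of_le' (one_le_of_mem_missingDims hr)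
  rw [Finset.sum_congr rfl fun v hv => by rw [Finset.card_erase_of_mem hv], Finset.sum_const,
    smul_eq_mul, Nat.add_sub_cancel]
  cases τ.card with
  | zero => simp
  | succ n => rw [Nat.add_sub_cancel, Nat.add_one_mul_choose_eq, mul_comm]

end Simplices

section LocalInequalities

lemma two_mul_sum_sq_le {ι R : Type*} [DecidableEq ι] [CommRing R] [LinearOrder R]
    [IsStrictOrderedRing R] {M : Finset ι} (hM : 2 ≤ M.card) (y : ι → R) :
    2 * (∑ v ∈ M, y v) ^ 2 ≤ ∑ v ∈ M, ∑ w ∈ M.erase v, (y v + y w) ^ 2 := by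
  have expand : ∑ v ∈ M, ∑ w ∈ M.erase v, (y v + y w) ^ 2 =
      2 * (∑ v ∈ M, y v) ^ 2 + 2 * ((M.card - 2) * ∑ v ∈ M, y v ^ 2) := by
    rw [Finset.sum_congr rfl fun v hv => Finset.sum_erase_eq_sub hv]
    simp only [add_sq, Finset.sum_sub_distrib, Finset.sum_add_distrib, Finset.sum_const,
      nsmul_eq_mul, ← Finset.mul_sum, ← Finset.sum_mul]
    simp only [mul_assoc, ← sq, ← Finset.mul_sum]
    ring
  have : (0 : R) ≤ M.card - 2 := sub_nonneg.2 (by exact_mod_cast hM)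
  rw [expand, le_add_iff_nonneg_right]
  positivity

lemma sum_inner_mul_sq_le {V E : Type*} [Fintype V] [NormedAddCommGroup E] [InnerProductSpace ℝ E]
    (p : V → E) (s z : V → ℝ) (hs : ∀ v, ∑ w, s w ^ 2 * inner ℝ (p v) (p w) ≤ 1) :
    ∑ v, ∑ w, inner ℝ (p v) (p w) * (s v * z w - s w * z v) ^ 2 ≤ 2 * ∑ v, z v ^ 2 := by
  set gram : V → V → ℝ := fun v w => inner ℝ (p v) (p w) with hgram
  have symm : ∑ v, ∑ w, z w ^ 2 * (s v ^ 2 * gram v w) =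
      ∑ v, ∑ w, z v ^ 2 * (s w ^ 2 * gram v w) := by
    rw [Finset.sum_comm]
    simp only [hgram, real_inner_comm]
  have nonneg : 0 ≤ ∑ v, ∑ w, s v * z v * (s w * z w * gram v w) := by
    have h := real_inner_self_nonneg (x := ∑ v, (s v * z v) • p v)
    rw [Finset.sum_comm]
    simpa only [sum_inner, inner_sum, real_inner_smul_left, real_inner_smul_right,
      real_inner_comm, hgram] using h
  have expand : ∑ v, ∑ w, gram v w * (s v * z w - s w * z v) ^ 2 =
      2 * ∑ v, z v ^ 2 * ∑ w, s w ^ 2 * gram v w -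
        2 * ∑ v, ∑ w, s v * z v * (s w * z w * gram v w) := by
    have pointwise (v w : V) : gram v w * (s v * z w - s w * z v) ^ 2 =
        z w ^ 2 * (s v ^ 2 * gram v w) + z v ^ 2 * (s w ^ 2 * gram v w) -
          2 * (s v * z v * (s w * z w * gram v w)) := by ring
    simp only [pointwise, Finset.sum_sub_distrib, Finset.sum_add_distrib, symm, ← Finset.mul_sum]
    ring
  have packing : ∑ v, z v ^ 2 * ∑ w, s w ^ 2 * gram v w ≤ ∑ v, z v ^ 2 :=
    Finset.sum_le_sum fun v _ => mul_le_of_le_one_right (sq_nonneg _) (hs v)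
  rw [expand]
  linarith

end LocalInequalities

section Energy

lemma creation_pair_sq {V R : Type*} [LinearOrder V] [CommRing R] (s : V → R)
    (φ : Finset V → R) {τ : Finset V} {v w : V} (hv : v ∈ τ) (hw : w ∈ τ.erase v) :
    (s v * creation v φ τ + s w * creation w φ τ) ^ 2 =
      (s v * annihilation w φ ((τ.erase v).erase w) -
        s w * annihilation v φ ((τ.erase v).erase w)) ^ 2 := by
  obtain ⟨ρ, hvρ, hwρ, rfl⟩ : ∃ ρ, v ∉ insert w ρ ∧ w ∉ ρ ∧ insert v (insert w ρ) = τ :=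
    ⟨(τ.erase v).erase w, by simp [Finset.insert_erase hw], Finset.notMem_erase w _,
      by rw [Finset.insert_erase hw, Finset.insert_erase hv]⟩
  obtain ⟨hvw, hv⟩ : v ≠ w ∧ v ∉ ρ := by simpa using hvρ
  have creation_v : creation v φ (insert v (insert w ρ)) =
      orderSign v (insert w ρ) * orderSign w ρ * annihilation w φ ρ := by
    rw [creation_insert hvρ, annihilation_of_notMem hwρ]
    linear_combination -orderSign v (insert w ρ) * φ (insert w ρ) *
      orderSign_mul_self (R := R) w ρ
  have creation_w : creation w φ (insert v (insert w ρ)) =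
      orderSign w (insert v ρ) * orderSign v ρ * annihilation v φ ρ := by
    rw [Finset.insert_comm, creation_insert (by simp [hvw.symm, hwρ]), annihilation_of_notMem hv]
    linear_combination -orderSign w (insert v ρ) * φ (insert v ρ) *
      orderSign_mul_self (R := R) v ρ
  rw [Finset.erase_insert hvρ, Finset.erase_insert hwρ, creation_v, creation_w,
    orderSign_insert_mul_orderSign hvw hv hwρ]
  linear_combination (s w * annihilation v φ ρ - s v * annihilation w φ ρ) ^ 2 *
    (orderSign v ρ * orderSign v ρ * orderSign_mul_self (R := R) w (insert v ρ) +
      orderSign_mul_self (R := R) v ρ)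

variable {V : Type*} [Fintype V] [LinearOrder V]

lemma sum_sum_sum_erase_erase_le {R : Type*} [AddCommMonoid R] [PartialOrder R]
    [IsOrderedAddMonoid R] {G : Finset V → V → V → R} (hG : ∀ ω v w, 0 ≤ G ω v w) :
    ∑ τ : Finset V, ∑ v ∈ τ, ∑ w ∈ τ.erase v, G ((τ.erase v).erase w) v w ≤
      ∑ ω, ∑ v, ∑ w, G ω v w := by
  calc ∑ τ : Finset V, ∑ v ∈ τ, ∑ w ∈ τ.erase v, G ((τ.erase v).erase w) v w
      = ∑ τ : Finset V, ∑ v ∈ τᶜ, ∑ w ∈ τ, G (τ.erase w) v w :=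
        sum_sum_mem_erase fun v τ => ∑ w ∈ τ, G (τ.erase w) v w
    _ ≤ ∑ τ : Finset V, ∑ v, ∑ w ∈ τ, G (τ.erase w) v w :=
        Finset.sum_le_sum fun τ _ => Finset.sum_le_univ_sum_of_nonneg
          fun v => Finset.sum_nonneg fun w _ => hG _ v w
    _ = ∑ v, ∑ τ : Finset V, ∑ w ∈ τᶜ, G τ v w := by
        rw [Finset.sum_comm]
        exact Finset.sum_congr rfl fun v _ => sum_sum_mem_erase fun w τ => G τ v w
    _ ≤ ∑ v, ∑ τ : Finset V, ∑ w, G τ v w :=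
        Finset.sum_le_sum fun v _ => Finset.sum_le_sum fun τ _ =>
          Finset.sum_le_univ_sum_of_nonneg fun w => hG τ v w
    _ = ∑ ω, ∑ v, ∑ w, G ω v w := Finset.sum_comm

variable {X : AbstractSimplicialComplex V}

/-- The sum of the Gram matrices of the maps `P.vec σ` over the index sets `σ` inside `ω`. -/
def gramSum (P : VectorRep X) (ω : Finset V) (v w : V) : ℝ :=
  ∑ σ ∈ repSets X with σ ⊆ ω, inner ℝ (P.vec σ v) (P.vec σ w)

lemma gramSum_nonneg (P : VectorRep X) (ω : Finset V) (v w : V) : 0 ≤ gramSum P ω v w :=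
  Finset.sum_nonneg fun σ hσ => P.nonneg σ (Finset.mem_filter.1 hσ).1 v w

lemma one_le_gramSum (P : VectorRep X) {M ω : Finset V} {v w : V} (hM : IsMissingFace X M)
    (hv : v ∈ M) (hw : w ∈ M.erase v) (hω : (M.erase v).erase w ⊆ ω) : 1 ≤ gramSum P ω v w := by
  have hσ := hM.erase_erase_mem_repSets hv hw
  have insert_insert : insert v (insert w ((M.erase v).erase w)) = M := by
    rw [Finset.insert_erase hw, Finset.insert_erase hv]
  refine (P.one_le _ hσ v w ?_ (insert_insert.symm ▸ hM)).trans
    (Finset.single_le_sum (f := fun σ => inner ℝ (P.vec σ v) (P.vec σ w))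
      (fun σ hσ => P.nonneg σ (Finset.mem_filter.1 hσ).1 v w) (Finset.mem_filter.2 ⟨hσ, hω⟩))
  rw [insert_insert, ← Finset.card_erase_add_one hv, ← Finset.card_erase_add_one hw]

lemma sum_gramSum_mul_sq_le (P : VectorRep X) {s : V → ℝ}
    (hP : ∀ σ ∈ repSets X, ∀ v, ∑ w, s w ^ 2 * inner ℝ (P.vec σ v) (P.vec σ w) ≤ 1)
    (ω : Finset V) (z : V → ℝ) :
    ∑ v, ∑ w, gramSum P ω v w * (s v * z w - s w * z v) ^ 2 ≤
      2 * ({σ ∈ repSets X | σ ⊆ ω}.card * ∑ v, z v ^ 2) := by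
  calc ∑ v, ∑ w, gramSum P ω v w * (s v * z w - s w * z v) ^ 2
      = ∑ σ ∈ repSets X with σ ⊆ ω, ∑ v, ∑ w,
          inner ℝ (P.vec σ v) (P.vec σ w) * (s v * z w - s w * z v) ^ 2 := by
        simp only [gramSum, Finset.sum_mul]
        exact (Finset.sum_congr rfl fun v _ => Finset.sum_comm).trans Finset.sum_comm
    _ ≤ ∑ σ ∈ repSets X with σ ⊆ ω, 2 * ∑ v, z v ^ 2 :=
        Finset.sum_le_sum fun σ hσ =>
          sum_inner_mul_sq_le (P.vec σ) s z (hP σ (Finset.mem_filter.1 hσ).1)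
    _ = 2 * ({σ ∈ repSets X | σ ⊆ ω}.card * ∑ v, z v ^ 2) := by
        rw [Finset.sum_const, nsmul_eq_mul]; ring

/-- A harmonic representative of a class in `ReducedHomology X k`, for the boundary weighted by
`s`: a chain of `X` that is a cycle and a cocycle. The coboundary is taken in the full simplex and
need not vanish outside `X`. -/
structure IsHarmonic (X : AbstractSimplicialComplex V) (s : V → ℝ) (k : ℕ)
    (φ : Finset V → ℝ) : Prop where
  eq_zero_of_notMem : ∀ σ ∉ faces X k, φ σ = 0
  weightedBoundary_eq_zero : weightedBoundary s φ = 0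
  weightedCoboundary_eq_zero : ∀ τ, IsSimplex X τ → weightedCoboundary s φ τ = 0

lemma weightedCoboundary_apply_of_not_isSimplex {s : V → ℝ} {φ : Finset V → ℝ}
    (hφ : ∀ σ, ¬ IsSimplex X σ → φ σ = 0) {M τ : Finset V} (hMτ : M ⊆ τ)
    (hM : ¬ IsSimplex X M) :
    weightedCoboundary s φ τ = ∑ v ∈ M, s v * creation v φ τ := by
  rw [weightedCoboundary_apply]
  refine (Finset.sum_subset (Finset.subset_univ M) fun v _ hv => ?_).symm
  by_cases hvτ : v ∈ τ
  · rw [creation_of_mem hvτ, hφ _ fun h => hM (h.mono (Finset.subset_erase.2 ⟨hMτ, hv⟩)),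
      mul_zero, mul_zero]
  · rw [creation_of_notMem hvτ, mul_zero]

lemma two_mul_weightedCoboundary_sq_le (P : VectorRep X) (s : V → ℝ) {φ : Finset V → ℝ}
    (hφ : ∀ σ, ¬ IsSimplex X σ → φ σ = 0) {τ : Finset V} (hτ : ¬ IsSimplex X τ) :
    2 * weightedCoboundary s φ τ ^ 2 ≤ ∑ v ∈ τ, ∑ w ∈ τ.erase v,
      gramSum P ((τ.erase v).erase w) v w *
        (s v * annihilation w φ ((τ.erase v).erase w) -
          s w * annihilation v φ ((τ.erase v).erase w)) ^ 2 := by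
  obtain ⟨M, hMτ, hM⟩ := exists_isMissingFace_subset hτ
  have term_nonneg (ω : Finset V) (v w : V) : 0 ≤ gramSum P ω v w *
      (s v * annihilation w φ ω - s w * annihilation v φ ω) ^ 2 :=
    mul_nonneg (gramSum_nonneg P ω v w) (sq_nonneg _)
  rw [weightedCoboundary_apply_of_not_isSimplex hφ hMτ hM.1]
  refine (two_mul_sum_sq_le hM.two_le_card _).trans ?_
  refine (Finset.sum_le_sum fun v hv => ?_).trans (Finset.sum_le_sum_of_subset_of_nonneg hMτ
    fun v _ _ => Finset.sum_nonneg fun w _ => term_nonneg _ v w)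
  refine (Finset.sum_le_sum fun w hw => ?_).trans (Finset.sum_le_sum_of_subset_of_nonneg
    (Finset.erase_subset_erase v hMτ) fun w _ _ => term_nonneg _ v w)
  rw [creation_pair_sq s φ (hMτ hv) (Finset.erase_subset_erase v hMτ hw)]
  exact le_mul_of_one_le_left (sq_nonneg _) (one_le_gramSum P hM hv hw
    (Finset.erase_subset_erase w (Finset.erase_subset_erase v hMτ)))

lemma sum_card_mul_annihilation_sq {k : ℕ} {φ : Finset V → ℝ}
    (hφ : ∀ σ ∉ faces X k, φ σ = 0) :
    ∑ ω, ({σ ∈ repSets X | σ ⊆ ω}.card : ℝ) * ∑ v, annihilation v φ ω ^ 2 =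
      (∑ r ∈ missingDims X, r * k.choose r : ℕ) * (φ ⬝ᵥ φ) := by
  rw [sum_sum_mul_annihilation_sq, dotProduct, Finset.mul_sum]
  refine Finset.sum_congr rfl fun τ _ => ?_
  by_cases hτ : τ ∈ faces X k
  · rw [← Nat.cast_sum, sum_card_filter_repSets_subset_erase, (mem_faces.1 hτ).2, sq]
  · rw [hφ τ hτ, sq, mul_zero, mul_zero, mul_zero]

lemma IsHarmonic.weightedCoboundary_dotProduct_self_le {s : V → ℝ} {k : ℕ} {φ : Finset V → ℝ}
    (hφ : IsHarmonic X s k φ) (P : VectorRep X)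
    (hP : ∀ σ ∈ repSets X, ∀ v, ∑ w, s w ^ 2 * inner ℝ (P.vec σ v) (P.vec σ w) ≤ 1) :
    weightedCoboundary s φ ⬝ᵥ weightedCoboundary s φ ≤
      (∑ r ∈ missingDims X, r * k.choose r : ℕ) * (φ ⬝ᵥ φ) := by
  have eq_zero (σ : Finset V) (hσ : ¬ IsSimplex X σ) : φ σ = 0 :=
    hφ.eq_zero_of_notMem σ fun h => hσ (mem_faces.1 h).1
  let pairEnergy (ω : Finset V) (v w : V) : ℝ := gramSum P ω v w *
    (s v * annihilation w φ ω - s w * annihilation v φ ω) ^ 2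
  have pairEnergy_nonneg (ω : Finset V) (v w : V) : 0 ≤ pairEnergy ω v w :=
    mul_nonneg (gramSum_nonneg P ω v w) (sq_nonneg _)
  have coboundary_sq_le (τ : Finset V) : 2 * weightedCoboundary s φ τ ^ 2 ≤
      ∑ v ∈ τ, ∑ w ∈ τ.erase v, pairEnergy ((τ.erase v).erase w) v w := by
    by_cases hτ : IsSimplex X τ
    · rw [hφ.weightedCoboundary_eq_zero τ hτ, sq, mul_zero, mul_zero]
      exact Finset.sum_nonneg fun v _ => Finset.sum_nonneg fun w _ => pairEnergy_nonneg _ v w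
    · exact two_mul_weightedCoboundary_sq_le P s eq_zero hτ
  refine le_of_mul_le_mul_left ?_ (zero_lt_two' ℝ)
  calc 2 * (weightedCoboundary s φ ⬝ᵥ weightedCoboundary s φ)
      = ∑ τ, 2 * weightedCoboundary s φ τ ^ 2 := by
        simp only [dotProduct, Finset.mul_sum, sq]
    _ ≤ ∑ ω, ∑ v, ∑ w, pairEnergy ω v w :=
        (Finset.sum_le_sum fun τ _ => coboundary_sq_le τ).trans
          (sum_sum_sum_erase_erase_le pairEnergy_nonneg)
    _ ≤ ∑ ω, 2 * ({σ ∈ repSets X | σ ⊆ ω}.card * ∑ v, annihilation v φ ω ^ 2) :=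
        Finset.sum_le_sum fun ω _ => sum_gramSum_mul_sq_le P hP ω fun v => annihilation v φ ω
    _ = 2 * ((∑ r ∈ missingDims X, r * k.choose r : ℕ) * (φ ⬝ᵥ φ)) := by
        rw [← Finset.mul_sum, sum_card_mul_annihilation_sq hφ.eq_zero_of_notMem]

lemma IsHarmonic.sum_sq_le {s : V → ℝ} {k : ℕ} {φ : Finset V → ℝ}
    (hφ : IsHarmonic X s k φ) (hφ₀ : φ ≠ 0) (P : VectorRep X)
    (hP : ∀ σ ∈ repSets X, ∀ v, ∑ w, s w ^ 2 * inner ℝ (P.vec σ v) (P.vec σ w) ≤ 1) :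
    ∑ v, s v ^ 2 ≤ (∑ r ∈ missingDims X, r * k.choose r : ℕ) := by
  have energy := weightedCoboundary_dotProduct_self_add s φ
  rw [hφ.weightedBoundary_eq_zero, zero_dotProduct, add_zero] at energy
  have pos : 0 < φ ⬝ᵥ φ := by
    simpa only [star_trivial] using Matrix.dotProduct_self_star_pos_iff.2 hφ₀
  refine le_of_mul_le_mul_right ?_ pos
  simp only [sq]
  exact energy.symm.trans_le (hφ.weightedCoboundary_dotProduct_self_le P hP)

end Energy

section Homology

variable {V : Type*} [Fintype V] {X : AbstractSimplicialComplex V} {s : V → ℝ} {k : ℕ}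

/-- Extension by zero of a chain of `X` to the full simplex, rescaled so as to turn the boundary
into the boundary weighted by `s`. -/
def weightedExtension (X : AbstractSimplicialComplex V) (s : V → ℝ) (k : ℕ) :
    (faces X k → ℝ) →ₗ[ℝ] (Finset V → ℝ) :=
  LinearMap.mulLeft ℝ (fun σ => (∏ v ∈ σ, s v)⁻¹) ∘ₗ
    Function.ExtendByZero.linearMap ℝ Subtype.val

lemma weightedExtension_apply (c : faces X k → ℝ) (σ : faces X k) :
    weightedExtension X s k c σ = (∏ v ∈ σ.1, s v)⁻¹ * c σ :=
  congrArg (_ * ·) (Subtype.val_injective.extend_apply c 0 σ)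

lemma weightedExtension_of_notMem (c : faces X k → ℝ) {σ : Finset V} (hσ : σ ∉ faces X k) :
    weightedExtension X s k c σ = 0 := by
  have extend_eq_zero : Function.extend Subtype.val c 0 σ = 0 :=
    Function.extend_apply' c _ σ fun ⟨τ, hτ⟩ => hσ (hτ ▸ τ.2)
  exact (congrArg (_ * ·) extend_eq_zero).trans (mul_zero _)

lemma weightedExtension_injective (hs : ∀ v, s v ≠ 0) :
    Function.Injective (weightedExtension X s k) := by
  refine fun c d h => funext fun σ => ?_
  have hσ := congrFun h σ
  rw [weightedExtension_apply, weightedExtension_apply] at hσ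
  exact mul_left_cancel₀ (inv_ne_zero (Finset.prod_ne_zero_iff.2 fun v _ => hs v)) hσ

variable [LinearOrder V]

lemma sum_incidence_mul (g : Finset V → ℝ) (τ : Finset V) :
    ∑ σ, incidence σ τ * g σ = ∑ v, annihilation v g τ := by
  have incidence_mul (σ : Finset V) : incidence σ τ * g σ =
      ∑ v ∈ σ, if σ.erase v = τ then orderSign v (σ.erase v) * g (insert v (σ.erase v)) else 0 := by
    rw [incidence, Finset.sum_mul]
    refine Finset.sum_congr rfl fun v hv => ?_
    rw [ite_mul, zero_mul, orderSign_erase_self, Finset.insert_erase hv, orderSign]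
  simp only [incidence_mul]
  rw [sum_sum_mem_erase fun v ω => if ω = τ then orderSign v ω * g (insert v ω) else 0]
  rw [Finset.sum_eq_single τ (fun ω _ hω => by simp [hω]) (by simp)]
  refine Finset.sum_subset_zero_on_sdiff (Finset.subset_univ _) (fun v hv => ?_) fun v hv => ?_
  · exact annihilation_of_mem (by simpa using hv) g
  · rw [if_pos rfl, annihilation_of_notMem (Finset.mem_compl.1 hv)]

lemma boundary_apply_eq_sum_annihilation (c : faces X (k + 1) → ℝ) (τ : faces X k) :
    boundary X k c τ = ∑ v, annihilation v (Function.extend Subtype.val c 0) τ := by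
  rw [← sum_incidence_mul, ← Finset.sum_subset (Finset.subset_univ (faces X (k + 1))),
    ← Finset.sum_coe_sort (faces X (k + 1))]
  · refine Finset.sum_congr rfl fun σ _ => ?_
    rw [Subtype.val_injective.extend_apply]
    rfl
  · intro σ _ hσ
    rw [Function.extend_apply' c _ σ fun ⟨τ, hτ⟩ => hσ (hτ ▸ τ.2), Pi.zero_apply, mul_zero]

lemma annihilation_eq_zero_of_notMem_faces {φ : Finset V → ℝ} (hφ : ∀ σ ∉ faces X (k + 1), φ σ = 0)
    {τ : Finset V} (hτ : τ ∉ faces X k) (v : V) : annihilation v φ τ = 0 := by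
  by_cases hv : v ∈ τ
  · exact annihilation_of_mem hv φ
  rw [annihilation_of_notMem hv, hφ, mul_zero]
  rw [mem_faces, Finset.card_insert_of_notMem hv]
  exact fun h => hτ (mem_faces.2 ⟨h.1.mono (Finset.subset_insert v τ), Nat.succ.inj h.2⟩)

lemma weightedBoundary_weightedExtension (hs : ∀ v, s v ≠ 0) (c : faces X (k + 1) → ℝ) :
    weightedBoundary s (weightedExtension X s (k + 1) c) =
      weightedExtension X s k (boundary X k c) := by
  ext τ
  by_cases hτ : τ ∈ faces X k
  · rw [weightedExtension_apply _ ⟨τ, hτ⟩, boundary_apply_eq_sum_annihilation]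
    exact weightedBoundary_prod_inv_mul hs _ τ
  · rw [weightedExtension_of_notMem _ hτ, weightedBoundary_apply]
    refine Finset.sum_eq_zero fun v _ => ?_
    rw [annihilation_eq_zero_of_notMem_faces (fun σ => weightedExtension_of_notMem c) hτ, mul_zero]

lemma weightedBoundary_weightedExtension_of_mem_cycles (hs : ∀ v, s v ≠ 0) {c : faces X k → ℝ}
    (hc : c ∈ cycles X k) : weightedBoundary s (weightedExtension X s k c) = 0 := by
  cases k with
  | zero =>
    ext τ
    rw [weightedBoundary_apply]
    refine Finset.sum_eq_zero fun v _ => ?_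
    by_cases hv : v ∈ τ
    · rw [annihilation_of_mem hv, mul_zero]
    · rw [annihilation_of_notMem hv, weightedExtension_of_notMem c (by simp [mem_faces]), mul_zero,
        mul_zero]
  | succ k =>
    have hc : boundary X k c = 0 := hc
    rw [weightedBoundary_weightedExtension hs, hc, map_zero]

lemma weightedExtension_single (τ : faces X k) (a : ℝ) :
    weightedExtension X s k (Pi.single τ a) = Pi.single τ.1 ((∏ v ∈ τ.1, s v)⁻¹ * a) := by
  ext σ
  by_cases hσ : σ ∈ faces X k
  · rw [weightedExtension_apply _ ⟨σ, hσ⟩, Pi.single_apply, Pi.single_apply]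
    by_cases h : σ = τ <;> simp [h, Subtype.ext_iff]
  · rw [weightedExtension_of_notMem _ hσ, Pi.single_eq_of_ne]
    rintro rfl
    exact hσ τ.2

lemma weightedCoboundary_eq_zero_of_card_ne {φ : Finset V → ℝ} (hφ : ∀ σ ∉ faces X k, φ σ = 0)
    {τ : Finset V} (hτ : τ.card ≠ k + 1) : weightedCoboundary s φ τ = 0 := by
  rw [weightedCoboundary_apply]
  refine Finset.sum_eq_zero fun v _ => ?_
  by_cases hv : v ∈ τ
  · rw [creation_of_mem hv, hφ, mul_zero, mul_zero]
    intro h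
    exact hτ (by rw [← Finset.card_erase_add_one hv, (mem_faces.1 h).2])
  · rw [creation_of_notMem hv, mul_zero]

lemma weightedCoboundary_eq_zero_of_forall_boundary (hs : ∀ v, s v ≠ 0) {φ : Finset V → ℝ}
    (hφ : ∀ d, φ ⬝ᵥ weightedExtension X s k (boundary X k d) = 0) {τ : Finset V}
    (hτ : τ ∈ faces X (k + 1)) : weightedCoboundary s φ τ = 0 := by
  have h := hφ (Pi.single ⟨τ, hτ⟩ 1)
  rw [← weightedBoundary_weightedExtension hs, ← weightedCoboundary_dotProduct,
    weightedExtension_single, dotProduct_single, mul_one] at h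
  exact (mul_eq_zero.1 h).resolve_right
    (inv_ne_zero (Finset.prod_ne_zero_iff.2 fun v _ => hs v))

lemma exists_mem_cycles_notMem_boundaries (hk : Nontrivial (ReducedHomology X k)) :
    ∃ c ∈ cycles X k, c ∉ boundaries X k := by
  by_contra! h
  exact Submodule.Quotient.nontrivial_iff.1 hk (Submodule.eq_top_iff'.2 fun x => h x.1 x.2)

lemma exists_mem_forall_sub_dotProduct_eq_zero {ι : Type*} [Fintype ι]
    (B : Submodule ℝ (ι → ℝ)) (c : ι → ℝ) : ∃ b ∈ B, ∀ b' ∈ B, (c - b) ⬝ᵥ b' = 0 := by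
  let e := WithLp.linearEquiv 2 ℝ (ι → ℝ)
  let B' : Submodule ℝ (EuclideanSpace ℝ ι) := B.comap e.toLinearMap
  obtain ⟨b, hb, z, hz, hbz⟩ := B'.exists_add_mem_mem_orthogonal (e.symm c)
  refine ⟨e b, hb, fun b' hb' => ?_⟩
  have h := (B'.mem_orthogonal z).1 hz (e.symm b') (by simpa [B'] using hb')
  rw [← h, eq_sub_of_add_eq' hbz.symm, PiLp.inner_apply]
  exact Finset.sum_congr rfl fun i _ => by simp [e]

lemma exists_isHarmonic (hs : ∀ v, s v ≠ 0) (hk : Nontrivial (ReducedHomology X k)) :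
    ∃ φ ≠ 0, IsHarmonic X s k φ := by
  obtain ⟨c, hc, hcb⟩ := exists_mem_cycles_notMem_boundaries hk
  obtain ⟨_, ⟨_, ⟨d, rfl⟩, rfl⟩, horth⟩ := exists_mem_forall_sub_dotProduct_eq_zero
    ((boundaries X k).map (weightedExtension X s k)) (weightedExtension X s k c)
  have support (σ : Finset V) (hσ : σ ∉ faces X k) :
      (weightedExtension X s k c - weightedExtension X s k (boundary X k d)) σ = 0 := by
    rw [← map_sub, weightedExtension_of_notMem _ hσ]
  refine ⟨_, fun h => hcb ⟨d, (weightedExtension_injective hs (sub_eq_zero.1 h)).symm⟩,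
    support, ?_, fun τ hτ => ?_⟩
  · rw [map_sub, weightedBoundary_weightedExtension_of_mem_cycles hs hc,
      ← weightedBoundary_weightedExtension hs, ← Module.End.mul_apply, weightedBoundary_mul_self,
      LinearMap.zero_apply, sub_zero]
  · by_cases hcard : τ.card = k + 1
    · exact weightedCoboundary_eq_zero_of_forall_boundary hs
        (fun d' => horth _ (Submodule.mem_map_of_mem ⟨d', rfl⟩)) (mem_faces.2 ⟨hτ, hcard⟩)
    · exact weightedCoboundary_eq_zero_of_card_ne support hcard

lemma sum_packing_le (P : VectorRep X) (hk : Nontrivial (ReducedHomology X k)) {f : V → ℝ}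
    (hf : ∀ v, 0 < f v)
    (hP : ∀ σ ∈ repSets X, ∀ v, ∑ w, f w * inner ℝ (P.vec σ v) (P.vec σ w) ≤ 1) :
    ∑ v, f v ≤ (∑ r ∈ missingDims X, r * k.choose r : ℕ) := by
  obtain ⟨φ, hφ₀, hφ⟩ := exists_isHarmonic (s := fun v => √(f v))
    (fun v => (Real.sqrt_pos.2 (hf v)).ne') hk
  have sq_sqrt (v : V) : √(f v) ^ 2 = f v := Real.sq_sqrt (hf v).le
  simpa only [sq_sqrt] using hφ.sum_sq_le hφ₀ P (by simpa only [sq_sqrt] using hP)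

end Homology

section Duality

variable {ι κ : Type*} [Fintype κ]

lemma exists_mulVec_le_vecMul [Fintype ι] [Nonempty ι] [Nonempty κ] (A : Matrix ι κ ℝ) :
    ∃ x ∈ stdSimplex ℝ ι, ∃ y ∈ stdSimplex ℝ κ, ∀ i j, (A *ᵥ y) i ≤ (x ᵥ* A) j := by
  classical
  let payoff : (ι → ℝ) →ₗ[ℝ] (κ → ℝ) →ₗ[ℝ] ℝ := Matrix.toLinearMap₂' ℝ A
  obtain ⟨y, hy, x, hx, saddle⟩ := Sion.exists_isSaddlePointOn (f := fun y x => payoff x y)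
    ⟨_, single_mem_stdSimplex ℝ (Classical.arbitrary κ)⟩ (convex_stdSimplex ℝ κ)
    (isCompact_stdSimplex ℝ κ)
    (fun x _ => (payoff x).continuous_of_finiteDimensional.lowerSemicontinuous
      |>.lowerSemicontinuousOn _)
    (fun x _ => ((payoff x).convexOn (convex_stdSimplex ℝ κ)).quasiconvexOn)
    (convex_stdSimplex ℝ ι) ⟨_, single_mem_stdSimplex ℝ (Classical.arbitrary ι)⟩
    (isCompact_stdSimplex ℝ ι)
    (fun y _ => (payoff.flip y).continuous_of_finiteDimensional.upperSemicontinuous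
      |>.upperSemicontinuousOn _)
    (fun y _ => ((payoff.flip y).concaveOn (convex_stdSimplex ℝ ι)).quasiconcaveOn)
  refine ⟨x, hx, y, hy, fun i j => ?_⟩
  have row_le_column : Pi.single i 1 ⬝ᵥ (A *ᵥ y) ≤ x ⬝ᵥ (A *ᵥ Pi.single j 1) := by
    simpa only [payoff, Matrix.toLinearMap₂'_apply'] using
      saddle _ (single_mem_stdSimplex ℝ j) _ (single_mem_stdSimplex ℝ i)
  rwa [single_one_dotProduct, Matrix.dotProduct_mulVec, dotProduct_single_one] at row_le_column

lemma exists_pos_sum_lt_mulVec_le_one [Finite ι] [Nonempty κ] (A : Matrix ι κ ℝ) {y : κ → ℝ}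
    (hy : ∀ j, 0 ≤ y j) (hAy : ∀ i, (A *ᵥ y) i < 1) :
    ∃ f : κ → ℝ, (∀ j, 0 < f j) ∧ (∀ i, (A *ᵥ f) i ≤ 1) ∧ ∑ j, y j < ∑ j, f j := by
  have small_row : ∀ᶠ ε in nhdsWithin (0 : ℝ) (Set.Ioi 0),
      ∀ i, ∑ j, A i j * (y j + ε) < 1 := by
    refine nhdsWithin_le_nhds (Filter.eventually_all.2 fun i => ?_)
    have hcont : Continuous fun ε : ℝ => ∑ j, A i j * (y j + ε) := by fun_prop
    exact hcont.continuousAt.eventually_lt continuousAt_const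
      (by simpa [Matrix.mulVec, dotProduct] using hAy i)
  obtain ⟨ε, hε, hε₀ : 0 < ε⟩ := (small_row.and self_mem_nhdsWithin).exists
  exact ⟨fun j => y j + ε, fun j => add_pos_of_nonneg_of_pos (hy j) hε₀, fun i => (hε i).le,
    Finset.sum_lt_sum_of_nonempty Finset.univ_nonempty fun j _ => lt_add_of_pos_right _ hε₀⟩

lemma exists_one_le_vecMul_or_exists_mulVec_le_one [Fintype ι] [Nonempty ι] [Nonempty κ]
    (A : Matrix ι κ ℝ) {c : ℝ} (hc : 0 ≤ c) :
    (∃ a : ι → ℝ, (∀ i, 0 ≤ a i) ∧ ∑ i, a i = c ∧ ∀ j, 1 ≤ (a ᵥ* A) j) ∨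
      ∃ f : κ → ℝ, (∀ j, 0 < f j) ∧ (∀ i, (A *ᵥ f) i ≤ 1) ∧ c < ∑ j, f j := by
  obtain ⟨x, ⟨hx₀, hx₁⟩, y, ⟨hy₀, hy₁⟩, hxy⟩ := exists_mulVec_le_vecMul A
  by_cases hdom : ∀ j, 1 ≤ c * (x ᵥ* A) j
  · refine .inl ⟨c • x, fun i => mul_nonneg hc (hx₀ i), ?_, fun j => ?_⟩
    · simp [← Finset.mul_sum, hx₁]
    · simpa [Matrix.smul_vecMul] using hdom j
  · push Not at hdom
    obtain ⟨j, hj⟩ := hdom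
    have row_lt (i : ι) : (A *ᵥ (c • y)) i < 1 := by
      rw [Matrix.mulVec_smul, Pi.smul_apply, smul_eq_mul]
      exact (mul_le_mul_of_nonneg_left (hxy i j) hc).trans_lt hj
    have sum_eq : ∑ j, (c • y) j = c := by simp [← Finset.mul_sum, hy₁]
    obtain ⟨f, hf, hAf, hsum⟩ :=
      exists_pos_sum_lt_mulVec_le_one A (fun j => mul_nonneg hc (hy₀ j)) row_lt
    exact .inr ⟨f, hf, hAf, sum_eq ▸ hsum⟩

end Duality

section VectorDominationNumber

variable {V : Type*} [Fintype V] {X : AbstractSimplicialComplex V}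

open Classical in
/-- The Gram matrices of all the maps `P.vec σ` stacked on top of each other: row `(σ, v)` holds the
inner products of `P.vec σ v` with the vectors `P.vec σ w`. The rows with `σ ∉ repSets X` are set
to zero, which spares a subtype as index set. -/
def VectorRep.gramMatrix [DecidableEq V] (P : VectorRep X) : Matrix (Finset V × V) V ℝ :=
  Matrix.of fun i w => if i.1 ∈ repSets X then inner ℝ (P.vec i.1 i.2) (P.vec i.1 w) else 0

lemma VectorRep.value_le_ofReal [DecidableEq V] (P : VectorRep X) {a : Finset V × V → ℝ}
    (ha : ∀ i, 0 ≤ a i) (hdom : ∀ w, 1 ≤ (a ᵥ* P.gramMatrix) w) :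
    P.value ≤ ENNReal.ofReal (∑ i, a i) := by
  have dominating : IsDominating P fun σ v => a (σ, v) := by
    refine ⟨fun σ _ v => ha _, fun w => (hdom w).trans_eq ?_⟩
    rw [Matrix.vecMul, dotProduct, Fintype.sum_prod_type]
    simp only [VectorRep.gramMatrix, Matrix.of_apply, mul_ite, mul_zero]
    exact (Finset.sum_subset (Finset.subset_univ _) fun σ _ hσ => by simp [hσ]).symm.trans
      (Finset.sum_congr rfl fun σ hσ => by simp [hσ])
  refine (iInf₂_le _ dominating).trans (ENNReal.ofReal_le_ofReal ?_)
  rw [Fintype.sum_prod_type]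
  exact Finset.sum_le_univ_sum_of_nonneg fun σ => Finset.sum_nonneg fun v _ => ha _

lemma VectorRep.value_le_of_nontrivial_reducedHomology [LinearOrder V] [Nonempty V]
    (P : VectorRep X) {k : ℕ} (hk : Nontrivial (ReducedHomology X k)) :
    P.value ≤ (∑ r ∈ missingDims X, r * k.choose r : ℕ) := by
  rcases exists_one_le_vecMul_or_exists_mulVec_le_one P.gramMatrix
    (Nat.cast_nonneg (∑ r ∈ missingDims X, r * k.choose r)) with
    ⟨a, ha, hsum, hdom⟩ | ⟨f, hf, hrow, hlt⟩
  · simpa only [hsum, ENNReal.ofReal_natCast] using P.value_le_ofReal ha hdom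
  · refine absurd (sum_packing_le P hk hf fun σ hσ v => ?_) hlt.not_ge
    simpa [VectorRep.gramMatrix, Matrix.mulVec, dotProduct, hσ, mul_comm] using hrow (σ, v)

lemma Gamma_le_of_nontrivial_reducedHomology [LinearOrder V] [Nonempty V] {k : ℕ}
    (hk : Nontrivial (ReducedHomology X k)) :
    Gamma X ≤ (∑ r ∈ missingDims X, r * k.choose r : ℕ) :=
  iSup_le fun P => P.value_le_of_nontrivial_reducedHomology hk

lemma Gamma_of_isEmpty [DecidableEq V] [IsEmpty V] : Gamma X = 0 := by
  refine le_antisymm (iSup_le fun P => ?_) zero_le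
  have dominating : IsDominating P 0 := ⟨fun _ _ _ => le_rfl, isEmptyElim⟩
  exact (iInf₂_le _ dominating).trans_eq (by simp)

lemma eta_eq_top_or_exists_nontrivial [LinearOrder V] :
    eta X = ⊤ ∨ ∃ k : ℕ, eta X = k ∧ Nontrivial (ReducedHomology X k) := by
  classical
  by_cases h : ∃ k, Nontrivial (ReducedHomology X k)
  · refine .inr ⟨Nat.find h, ?_, Nat.find_spec h⟩
    exact le_antisymm (iInf₂_le (Nat.find h) (Nat.find_spec h))
      (le_iInf₂ fun s hs => Nat.cast_le.2 (Nat.find_min' h hs))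
  · exact .inl (iInf₂_eq_top.2 fun s hs => (h ⟨s, hs⟩).elim)

lemma enatChoose_natCast (n r : ℕ) : enatChoose n r = (n.choose r : ℕ) := rfl

lemma enatChoose_top {r : ℕ} (hr : 1 ≤ r) : enatChoose ⊤ r = ⊤ := by
  obtain ⟨q, rfl⟩ := Nat.exists_eq_add_of_le' hr
  rfl

lemma sum_mul_enatChoose_top (hX : (missingDims X).Nonempty) :
    ∑ r ∈ missingDims X, (r : ℕ∞) * enatChoose ⊤ r = ⊤ := by
  obtain ⟨r, hr⟩ := hX
  have hr₁ : 1 ≤ r := one_le_of_mem_missingDims hr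
  exact ENat.sum_eq_top.2 ⟨r, hr, by rw [enatChoose_top hr₁, ENat.mul_top (by positivity)]⟩

end VectorDominationNumber

end VectorDomination

end

theorem mainTheorem1 {V : Type*} [Fintype V] [LinearOrder V] (X : AbstractSimplicialComplex V)
    (hX : Finset.univ ∉ X) :
    VectorDomination.Gamma X ≤
      ((∑ r ∈ VectorDomination.missingDims X,
        (r : ℕ∞) * VectorDomination.enatChoose (VectorDomination.eta X) r : ℕ∞) : ℝ≥0∞) := by
  rcases isEmpty_or_nonempty V with hV | hV
  · exact VectorDomination.Gamma_of_isEmpty.trans_le zero_le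
  rcases VectorDomination.eta_eq_top_or_exists_nontrivial (X := X) with hη | ⟨k, hη, hk⟩
  · rw [hη, VectorDomination.sum_mul_enatChoose_top (VectorDomination.missingDims_nonempty hX)]
    exact le_top
  · refine (VectorDomination.Gamma_le_of_nontrivial_reducedHomology hk).trans_eq ?_
    rw [← ENat.toENNReal_coe]
    simp [hη, VectorDomination.enatChoose_natCast]
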